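/- Let $\Omega=\{0,1\}^{\mathbb N}$ be the Cantor space and $\mathcal M(\Omega)$ the set of all (Borel) probability measures on $\Omega$. For a finite binary word $x$ let $x\Omega$ be the set of all sequences that begin with $x$, write $x\sqsubseteq\omega$ for $\omega\in x\Omega$, and write $P(x)$ for $P(x\Omega)$. A basic open set $\beta\subseteq\mathcal M(\Omega)$ is given by finitely many conditions $u<P(y)<v$ with binary words $y$ and rationals $u,v$. A function $t\colon\Omega\times\mathcal M(\Omega)\to[0,\infty]$ is lower semicomputable if there is an algorithm that, given a rational $r$, enumerates sets $x\Omega\times\beta$ with union $\{(\omega,P): r<t(\omega,P)\}$. A function $f\colon\{0,1\}^*\times\mathcal M(\Omega)\to[0,\infty]$ is lower semicomputable if there is an algorithm that, given a rational $r$ and a word $x$, enumerates basic open sets $\beta$ with union $\{P: r<f(x,P)\}$. A uniform test is a lower semicomputable $t\colon\Omega\times\mathcal M(\Omega)\to[0,\infty]$ with $\int t(\omega,P)\,dP(\omega)\le 1$ for every $P\in\mathcal M(\Omega)$. It is universal if for every uniform test $t'$ there is a constant $c$ with $t'(\omega,P)\le c\,t(\omega,P)$ for all $\omega,P$. A uniform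 lower semicomputable semimeasure is a lower semicomputable $f\colon\{0,1\}^*\times\mathcal M(\Omega)\to[0,\infty]$ with $\sum_x f(x,P)\le 1$ for every $P\in\mathcal M(\Omega)$. It is maximal if for every uniform lower semicomputable semimeasure $f'$ there is a constant $c$ with $f'(x,P)\le c\,f(x,P)$ for all $x,P$. Theorem. Let $\mathbf t(\omega,P)$ be any universal uniform test and $\mathbf m(x\mid P)$ any maximal uniform lower semicomputable semimeasure. Then $$\mathbf t(\omega,P)\stackrel{\cdot}{=}\sum_{x\sqsubseteq\omega}\frac{\mathbf m(x\mid P)}{P(x)},$$ that is, there are constants $c_1,c_2<\infty$, not depending on $\omega$ or $P$, such that for all $\omega\in\Omega$ and $P\in\mathcal M(\Omega)$ the left side is at most $c_1$ times the right side and the right side is at most $c_2$ times the left side. The sum is over all finite initial segments $x$ of $\omega$, including the empty word, and a term with $P(x)=0$ and $\mathbf m(x\mid P)>0$ is $\infty$. -/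

import Mathlib

open MeasureTheory
open scoped ENNReal NNReal

namespace CantorRandomness

/-- The binary Cantor space of infinite binary sequences, with its product topology and
product (equivalently, Borel) sigma-algebra. -/
abbrev Omega : Type := ℕ → Bool

/-- Finite binary words. -/
abbrev Word : Type := List Bool

/-- `IsInitial x ω`: the word `x` is an initial segment of the sequence `ω`. -/
def IsInitial (x : Word) (ω : Omega) : Prop :=
  ∀ (i : ℕ) (h : i < x.length), ω i = x[i]

/-- The interval `xΩ` of all sequences that begin with `x`. -/
def cyl (x : Word) : Set Omega := {ω | IsInitial x ω}

/-- A rational number as a finite object: a numerator `a` and a natural number `b`. -/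
abbrev RatCode : Type := ℤ × ℕ

/-- The rational number `a / (b + 1)` presented by the pair `(a, b)`. -/
def RatCode.val (q : RatCode) : ℚ := (q.1 : ℚ) / ((q.2 : ℚ) + 1)

/-- A basic open set in the space of measures as a finite object: a finite list of triples
`(y, u, v)`, each standing for the condition `u < P(y) < v`. -/
abbrev BoxCode : Type := List (Word × RatCode × RatCode)

/-- The set of probability measures satisfying all the conditions on the list. -/
def BoxCode.toSet (β : BoxCode) : Set (ProbabilityMeasure Omega) :=
  {P | ∀ e ∈ β, (e.2.1.val : ℝ) < (P : Measure Omega).real (cyl e.1) ∧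
    (P : Measure Omega).real (cyl e.1) < (e.2.2.val : ℝ)}

/-- `r < a`, for a rational `r` and `a ∈ [0, ∞]`. -/
def RatLT (r : ℚ) (a : ℝ≥0∞) : Prop := ((r : ℝ) : EReal) < (a : EReal)

/-- A function of a sequence and a measure is lower semicomputable if some algorithm, given a
rational `r`, enumerates basic open sets `xΩ × β` whose union is `{(ω, P) | r < t(ω, P)}`. -/
def LowerSemicomputable (t : Omega → ProbabilityMeasure Omega → ℝ≥0∞) : Prop :=
  ∃ A : RatCode × Word × BoxCode → Prop, REPred A ∧
    ∀ (r : RatCode) (ω : Omega) (P : ProbabilityMeasure Omega),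
      RatLT r.val (t ω P) ↔ ∃ (x : Word) (β : BoxCode), A (r, x, β) ∧ ω ∈ cyl x ∧ P ∈ β.toSet

/-- A function of a word and a measure is lower semicomputable if some algorithm, given a
rational `r` and a word `x`, enumerates basic open sets whose union is `{P | r < f(x, P)}`. -/
def LowerSemicomputableOnWords (f : Word → ProbabilityMeasure Omega → ℝ≥0∞) : Prop :=
  ∃ A : RatCode × Word × BoxCode → Prop, REPred A ∧
    ∀ (r : RatCode) (x : Word) (P : ProbabilityMeasure Omega),
      RatLT r.val (f x P) ↔ ∃ β : BoxCode, A (r, x, β) ∧ P ∈ β.toSet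

/-- Uniform tests. -/
structure IsUniformTest (t : Omega → ProbabilityMeasure Omega → ℝ≥0∞) : Prop where
  lowerSemicomputable : LowerSemicomputable t
  lintegral_le_one : ∀ P : ProbabilityMeasure Omega, ∫⁻ ω, t ω P ∂(P : Measure Omega) ≤ 1

/-- Universal uniform tests: those maximal up to a constant factor. -/
structure IsUniversalUniformTest (t : Omega → ProbabilityMeasure Omega → ℝ≥0∞) : Prop where
  isUniformTest : IsUniformTest t
  maximal : ∀ t' : Omega → ProbabilityMeasure Omega → ℝ≥0∞, IsUniformTest t' →
    ∃ c : ℝ≥0, ∀ ω P, t' ω P ≤ c * t ω P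

/-- Uniform lower semicomputable (discrete) semimeasures. -/
structure IsUniformSemimeasure (f : Word → ProbabilityMeasure Omega → ℝ≥0∞) : Prop where
  lowerSemicomputable : LowerSemicomputableOnWords f
  tsum_le_one : ∀ P : ProbabilityMeasure Omega, ∑' x : Word, f x P ≤ 1

/-- A priori probability with respect to a measure: a uniform lower semicomputable semimeasure
that is maximal up to a constant factor. -/
structure IsAprioriProbability (m : Word → ProbabilityMeasure Omega → ℝ≥0∞) : Prop where
  isUniformSemimeasure : IsUniformSemimeasure m
  maximal : ∀ f : Word → ProbabilityMeasure Omega → ℝ≥0∞, IsUniformSemimeasure f →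
    ∃ c : ℝ≥0, ∀ x P, f x P ≤ c * m x P

/-- The sum of `m(x | P) / P(x)` over all initial segments `x` of `ω`. Division is that of
`[0, ∞]`: a positive number divided by `0` is `∞`. -/
noncomputable def initialSum (m : Word → ProbabilityMeasure Omega → ℝ≥0∞)
    (ω : Omega) (P : ProbabilityMeasure Omega) : ℝ≥0∞ :=
  ∑' x : {x : Word // IsInitial x ω}, m x P / (P : Measure Omega) (cyl x)

/-- Equality up to a bounded factor of two functions of a sequence and a measure. -/
def EqUpToFactor (f g : Omega → ProbabilityMeasure Omega → ℝ≥0∞) : Prop :=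
  (∃ c : ℝ≥0, ∀ ω P, f ω P ≤ c * g ω P) ∧ (∃ c : ℝ≥0, ∀ ω P, g ω P ≤ c * f ω P)

end CantorRandomness

/-! The right side is a uniform test: by Tonelli its integral is at most the sum over all `x` of
`m(x | P)`, and it is a supremum of finite prefix sums that are lower semicomputable. Universality
of `t` bounds it by a multiple of `t` (`isUniformTest_initialSum`).

For the other bound, a test `t` is split into increments along words: if `t` is the supremum of a
monotone function on the prefixes of `ω`, then (increment at `x`) times `P(x)` sums over all `x` to
the integral of `t`. If this product is lower semicomputable, it is a semimeasure, hence at most `c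
* m(x | P)`; dividing by `P(x)` and summing along `ω` gives the bound
(`IsAprioriProbability.test_le_initialSum`).

The obstacle is the subtraction: an increment is lower semicomputable only if the approximation can
be bounded effectively from above as well, and indicators of basic open sets cannot. They are
replaced by the continuous functions `hat`, which rise to the indicators (times a rational) and are
computable from both sides. All semicomputability is expressed by `EffectivelyOpen`, whose closure
properties replace explicit algorithms. -/

namespace CantorRandomness

/-! ### Primitive recursive arithmetic on integers and coded rationals -/

theorem encode_int_natCast (n : ℕ) : Encodable.encode (n : ℤ) = 2 * n := rfl

theorem encode_int_negSucc (n : ℕ) : Encodable.encode (Int.negSucc n) = 2 * n + 1 := rfl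

/-- Nonnegative integers have even codes and negative ones odd codes, so sign and size are the
parity and the half of the code. -/
theorem primrec_int_toNat : Primrec Int.toNat := by
  have h : Primrec fun z : ℤ => cond (Encodable.encode z).bodd 0 (Encodable.encode z).div2 :=
    Primrec.cond (Primrec.nat_bodd.comp Primrec.encode) (Primrec.const 0)
      (Primrec.nat_div2.comp Primrec.encode)
  refine h.of_eq fun z => ?_
  rcases z with n | n
  · simp [encode_int_natCast, Nat.div2_val]
  · simp [encode_int_negSucc]

theorem primrec_int_natSub : Primrec₂ fun a b : ℕ => (a : ℤ) - (b : ℤ) := by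
  refine Primrec₂.encode_iff.1 ?_
  have h : Primrec₂ fun a b : ℕ => if b ≤ a then 2 * (a - b) else 2 * (b - a - 1) + 1 :=
    Primrec.ite (Primrec.nat_le.comp Primrec.snd Primrec.fst)
      (Primrec.nat_double.comp (Primrec.nat_sub.comp Primrec.fst Primrec.snd))
      (Primrec.nat_double_succ.comp
        (Primrec.nat_sub.comp (Primrec.nat_sub.comp Primrec.snd Primrec.fst) (Primrec.const 1)))
  refine h.of_eq fun a b => ?_
  split_ifs with hab
  · rw [← encode_int_natCast, Nat.cast_sub hab]
  · rw [← encode_int_negSucc]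
    congr 1
    omega

theorem primrec_natCast_int : Primrec fun n : ℕ => (n : ℤ) :=
  (primrec_int_natSub.comp Primrec.id (Primrec.const 0)).of_eq fun n => by simp

theorem primrec_int_neg : Primrec fun z : ℤ => -z := by
  have hneg : Primrec fun z : ℤ => (-z).toNat := by
    have h : Primrec fun z : ℤ => cond (Encodable.encode z).bodd
        ((Encodable.encode z).div2 + 1) 0 :=
      Primrec.cond (Primrec.nat_bodd.comp Primrec.encode)
        (Primrec.succ.comp (Primrec.nat_div2.comp Primrec.encode)) (Primrec.const 0)
    refine h.of_eq fun z => ?_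
    rcases z with n | n
    · simp [encode_int_natCast]
    · simp [encode_int_negSucc, Nat.div2_val]
  exact (primrec_int_natSub.comp hneg primrec_int_toNat).of_eq fun z => by omega

/-- Integer arithmetic reduces to natural numbers by writing each integer as positive part minus
negative part. -/
theorem primrec_int_add : Primrec₂ fun a b : ℤ => a + b := by
  have p := primrec_int_toNat
  have n := primrec_int_toNat.comp primrec_int_neg
  refine Primrec₂.of_eq (f := fun a b : ℤ =>
    ((a.toNat + b.toNat : ℕ) : ℤ) - (((-a).toNat + (-b).toNat : ℕ) : ℤ)) ?_ fun a b => by omega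
  exact primrec_int_natSub.comp
    (Primrec.nat_add.comp (p.comp Primrec.fst) (p.comp Primrec.snd))
    (Primrec.nat_add.comp (n.comp Primrec.fst) (n.comp Primrec.snd))

theorem primrec_int_mul : Primrec₂ fun a b : ℤ => a * b := by
  have p := primrec_int_toNat
  have n := primrec_int_toNat.comp primrec_int_neg
  refine Primrec₂.of_eq (f := fun a b : ℤ =>
    ((a.toNat * b.toNat + (-a).toNat * (-b).toNat : ℕ) : ℤ) -
      ((a.toNat * (-b).toNat + (-a).toNat * b.toNat : ℕ) : ℤ)) ?_ fun a b => ?_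
  · exact primrec_int_natSub.comp
      (Primrec.nat_add.comp
        (Primrec.nat_mul.comp (p.comp Primrec.fst) (p.comp Primrec.snd))
        (Primrec.nat_mul.comp (n.comp Primrec.fst) (n.comp Primrec.snd)))
      (Primrec.nat_add.comp
        (Primrec.nat_mul.comp (p.comp Primrec.fst) (n.comp Primrec.snd))
        (Primrec.nat_mul.comp (n.comp Primrec.fst) (p.comp Primrec.snd)))
  · have ha : a = (a.toNat : ℤ) - ((-a).toNat : ℤ) := by omega
    have hb : b = (b.toNat : ℤ) - ((-b).toNat : ℤ) := by omega
    conv_rhs => rw [ha, hb]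
    push_cast
    ring

theorem primrec_int_lt : PrimrecRel fun a b : ℤ => a < b := by
  have h : PrimrecRel fun a b : ℤ => 0 < (b + -a).toNat :=
    Primrec.nat_lt.comp (Primrec.const 0) (primrec_int_toNat.comp
      (primrec_int_add.comp Primrec.snd (primrec_int_neg.comp Primrec.fst)))
  exact h.of_eq fun a b => by omega

namespace RatCode

/-- The sum of two coded rationals. -/
def add (p q : RatCode) : RatCode :=
  (p.1 * ((q.2 + 1 : ℕ) : ℤ) + q.1 * ((p.2 + 1 : ℕ) : ℤ), p.2 * q.2 + p.2 + q.2)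

/-- The product of two coded rationals. -/
def mul (p q : RatCode) : RatCode := (p.1 * q.1, p.2 * q.2 + p.2 + q.2)

/-- The negative of a coded rational. -/
def neg (p : RatCode) : RatCode := (-p.1, p.2)

/-- The quotient of a coded rational by `n + 1`. -/
def divSucc (p : RatCode) (n : ℕ) : RatCode := (p.1, p.2 * n + p.2 + n)

theorem val_add (p q : RatCode) : (add p q).val = p.val + q.val := by
  have hp : (p.2 : ℚ) + 1 ≠ 0 := by positivity
  have hq : (q.2 : ℚ) + 1 ≠ 0 := by positivity
  have : (p.2 : ℚ) * q.2 + p.2 + q.2 + 1 = (p.2 + 1) * (q.2 + 1) := by ring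
  simp only [val, add]
  push_cast
  rw [this]
  field_simp

theorem val_mul (p q : RatCode) : (mul p q).val = p.val * q.val := by
  have : (p.2 : ℚ) * q.2 + p.2 + q.2 + 1 = (p.2 + 1) * (q.2 + 1) := by ring
  simp only [val, mul]
  push_cast
  rw [this, div_mul_div_comm]

theorem val_neg (p : RatCode) : (neg p).val = -p.val := by
  simp only [val, neg]
  push_cast
  rw [neg_div]

theorem val_divSucc (p : RatCode) (n : ℕ) : (divSucc p n).val = p.val / (n + 1) := by
  have : (p.2 : ℚ) * n + p.2 + n + 1 = (p.2 + 1) * (n + 1) := by ring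
  simp only [val, divSucc]
  push_cast
  rw [this, div_div]

theorem val_natCast (n : ℕ) : val ((n : ℤ), 0) = n := by simp [val]

theorem val_zero : val (0, 0) = 0 := by simp [val]

theorem exists_val_eq (q : ℚ) : ∃ p : RatCode, p.val = q := by
  refine ⟨(q.num, q.den - 1), ?_⟩
  have h : ((q.den - 1 : ℕ) : ℚ) + 1 = q.den := by
    rw [Nat.cast_sub q.pos]; simp
  simp only [val]
  rw [h, Rat.num_div_den]

theorem primrec_succ_mul_succ_pred : Primrec₂ fun a b : ℕ => a * b + a + b :=
  Primrec.nat_add.comp (Primrec.nat_add.comp (Primrec.nat_mul.comp Primrec.fst Primrec.snd)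
    Primrec.fst) Primrec.snd

theorem primrec_add : Primrec₂ add := by
  have n1 : Primrec fun x : RatCode × RatCode => x.1.1 := Primrec.fst.comp Primrec.fst
  have d1 : Primrec fun x : RatCode × RatCode => x.1.2 := Primrec.snd.comp Primrec.fst
  have n2 : Primrec fun x : RatCode × RatCode => x.2.1 := Primrec.fst.comp Primrec.snd
  have d2 : Primrec fun x : RatCode × RatCode => x.2.2 := Primrec.snd.comp Primrec.snd
  exact Primrec.pair
    (primrec_int_add.comp
      (primrec_int_mul.comp n1 (primrec_natCast_int.comp (Primrec.succ.comp d2)))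
      (primrec_int_mul.comp n2 (primrec_natCast_int.comp (Primrec.succ.comp d1))))
    (primrec_succ_mul_succ_pred.comp d1 d2)

theorem primrec_mul : Primrec₂ mul :=
  Primrec.pair
    (primrec_int_mul.comp (Primrec.fst.comp Primrec.fst) (Primrec.fst.comp Primrec.snd))
    (primrec_succ_mul_succ_pred.comp (Primrec.snd.comp Primrec.fst)
      (Primrec.snd.comp Primrec.snd))

theorem primrec_neg : Primrec neg :=
  Primrec.pair (primrec_int_neg.comp Primrec.fst) Primrec.snd

theorem primrec_divSucc : Primrec₂ divSucc :=
  Primrec.pair (Primrec.fst.comp Primrec.fst)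
    (primrec_succ_mul_succ_pred.comp (Primrec.snd.comp Primrec.fst) Primrec.snd)

theorem primrec_lt : PrimrecRel fun p q : RatCode => p.val < q.val := by
  have h : PrimrecRel fun p q : RatCode =>
      p.1 * ((q.2 + 1 : ℕ) : ℤ) < q.1 * ((p.2 + 1 : ℕ) : ℤ) :=
    primrec_int_lt.comp
      (primrec_int_mul.comp (Primrec.fst.comp Primrec.fst)
        (primrec_natCast_int.comp (Primrec.succ.comp (Primrec.snd.comp Primrec.snd))))
      (primrec_int_mul.comp (Primrec.fst.comp Primrec.snd)
        (primrec_natCast_int.comp (Primrec.succ.comp (Primrec.snd.comp Primrec.fst))))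
  refine h.of_eq fun p q => ?_
  have hp : (0 : ℚ) < (p.2 : ℚ) + 1 := by positivity
  have hq : (0 : ℚ) < (q.2 : ℚ) + 1 := by positivity
  simp only [val]
  rw [div_lt_div_iff₀ hp hq]
  exact_mod_cast Iff.rfl

theorem primrec_neg_iff : PrimrecPred fun p : RatCode => p.val < 0 :=
  (primrec_lt.comp Primrec.id (Primrec.const (0, 0))).of_eq fun p => by simp [val_zero]

theorem primrec_pos_iff : PrimrecPred fun p : RatCode => 0 < p.val :=
  (primrec_lt.comp (Primrec.const (0, 0)) Primrec.id).of_eq fun p => by simp [val_zero]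

theorem exists_val_btwn {a b : ℝ} (h : a < b) :
    ∃ p : RatCode, a < (p.val : ℝ) ∧ (p.val : ℝ) < b := by
  obtain ⟨q, h1, h2⟩ := exists_rat_btwn h
  obtain ⟨p, rfl⟩ := exists_val_eq q
  exact ⟨p, h1, h2⟩

end RatCode

/-! ### Normal form of enumerable predicates -/

/-- Kleene normal form: `s` bounds the computation in `evaln`, which is primitive recursive. -/
theorem exists_primrec_of_rePred {α : Type*} [Primcodable α] {p : α → Prop} (hp : REPred p) :
    ∃ g : α → ℕ → Bool, Primrec₂ g ∧ ∀ a, p a ↔ ∃ s, g a s = true := by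
  obtain ⟨c, hc⟩ := Nat.Partrec.Code.exists_code.1 hp
  refine ⟨fun a s => (c.evaln s (Encodable.encode a)).isSome, ?_, fun a => ?_⟩
  · exact Primrec.option_isSome.comp (Nat.Partrec.Code.primrec_evaln.comp
      (Primrec.pair (Primrec.pair Primrec.snd (Primrec.const c))
        (Primrec.encode.comp Primrec.fst)))
  · have h : p a ↔ (c.eval (Encodable.encode a)).Dom := by
      rw [hc]
      simp [Encodable.encodek, Part.assert]
    rw [h, Part.dom_iff_mem]
    simp only [Nat.Partrec.Code.evaln_complete, Option.isSome_iff_exists, Option.mem_def]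
    exact exists_comm

theorem rePred_of_primrec {α : Type*} [Primcodable α] {g : α → ℕ → Bool} (hg : Primrec₂ g) :
    REPred fun a => ∃ s, g a s = true := by
  have h : Partrec fun a => Nat.rfind fun s => Part.some (g a s) :=
    Partrec.rfind hg.to_comp.partrec₂
  refine h.dom_re.of_eq fun a => ?_
  refine Nat.rfind_dom.trans ⟨fun ⟨s, hs, _⟩ => ⟨s, (Part.mem_some_iff.1 hs).symm⟩,
    fun ⟨s, hs⟩ => ⟨s, Part.mem_some_iff.2 hs.symm, fun _ => trivial⟩⟩

/-! ### Effectively open relations between finite objects and measures -/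

/-- A relation between finite objects and measures is effectively open if the sets of measures
it defines are unions of primitive recursively enumerated basic open sets. -/
def EffectivelyOpen {α : Type*} [Primcodable α] (R : α → ProbabilityMeasure Omega → Prop) :
    Prop :=
  ∃ G : α → ℕ → BoxCode, Primrec₂ G ∧ ∀ a P, R a P ↔ ∃ s, P ∈ (G a s).toSet

/-- A contradictory list of conditions. -/
def emptyBox : BoxCode := [([], (0, 0), (0, 0))]

theorem notMem_emptyBox (P : ProbabilityMeasure Omega) : P ∉ emptyBox.toSet := by
  intro h
  have := h ([], (0, 0), (0, 0)) (by simp [emptyBox])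
  exact lt_asymm this.1 this.2

theorem mem_nilBox (P : ProbabilityMeasure Omega) : P ∈ BoxCode.toSet [] := by
  simp [BoxCode.toSet]

theorem mem_appendBox {P : ProbabilityMeasure Omega} {β γ : BoxCode} :
    P ∈ BoxCode.toSet (β ++ γ) ↔ P ∈ β.toSet ∧ P ∈ γ.toSet := by
  simp only [BoxCode.toSet, Set.mem_ofPred_eq, List.mem_append]
  exact ⟨fun h => ⟨fun e he => h e (.inl he), fun e he => h e (.inr he)⟩,
    fun h e he => he.elim (h.1 e) (h.2 e)⟩

theorem mem_flatMapBox {ι : Type*} {P : ProbabilityMeasure Omega} {l : List ι}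
    {f : ι → BoxCode} : P ∈ BoxCode.toSet (l.flatMap f) ↔ ∀ i ∈ l, P ∈ (f i).toSet := by
  simp only [BoxCode.toSet, Set.mem_ofPred_eq, List.mem_flatMap]
  exact ⟨fun h i hi e he => h e ⟨i, hi, he⟩, fun h e ⟨i, hi, he⟩ => h i hi e he⟩

namespace EffectivelyOpen

variable {α β : Type*} [Primcodable α] [Primcodable β]

theorem of_iff {R S : α → ProbabilityMeasure Omega → Prop} (hR : EffectivelyOpen R)
    (h : ∀ a P, S a P ↔ R a P) : EffectivelyOpen S := by
  obtain ⟨G, hG, hGR⟩ := hR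
  exact ⟨G, hG, fun a P => (h a P).trans (hGR a P)⟩

theorem comp {R : α → ProbabilityMeasure Omega → Prop} (hR : EffectivelyOpen R) {f : β → α}
    (hf : Primrec f) : EffectivelyOpen fun b P => R (f b) P := by
  obtain ⟨G, hG, hGR⟩ := hR
  exact ⟨fun b => G (f b), hG.comp (hf.comp Primrec.fst) Primrec.snd, fun b P => hGR (f b) P⟩

theorem mem_box {f : α → BoxCode} (hf : Primrec f) :
    EffectivelyOpen fun a P => P ∈ (f a).toSet :=
  ⟨fun a _ => f a, hf.comp Primrec.fst, fun _ _ => ⟨fun h => ⟨0, h⟩, fun ⟨_, h⟩ => h⟩⟩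

theorem of_rePred {p : α → Prop} (hp : REPred p) : EffectivelyOpen fun a _ => p a := by
  obtain ⟨g, hg, hgp⟩ := exists_primrec_of_rePred hp
  -- A stage contributes the whole space once `p a` is confirmed, and nothing otherwise.
  refine ⟨fun a s => cond (g a s) [] emptyBox,
    Primrec.cond hg (Primrec.const _) (Primrec.const _), fun a P => ?_⟩
  refine (hgp a).trans (exists_congr fun s => ?_)
  cases hb : g a s <;> simp [hb, mem_nilBox, notMem_emptyBox]

theorem of_primrecPred {p : α → Prop} (hp : PrimrecPred p) :
    EffectivelyOpen fun a _ => p a := by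
  classical
  refine ⟨fun a _ => if p a then [] else emptyBox,
    Primrec.ite (hp.comp Primrec.fst) (Primrec.const _) (Primrec.const _), fun a P => ?_⟩
  by_cases h : p a <;> simp [h, mem_nilBox, notMem_emptyBox]

theorem and {R S : α → ProbabilityMeasure Omega → Prop} (hR : EffectivelyOpen R)
    (hS : EffectivelyOpen S) : EffectivelyOpen fun a P => R a P ∧ S a P := by
  obtain ⟨G, hG, hGR⟩ := hR
  obtain ⟨H, hH, hHS⟩ := hS
  refine ⟨fun a s => G a s.unpair.1 ++ H a s.unpair.2, ?_, fun a P => ?_⟩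
  · exact Primrec.list_append.comp
      (hG.comp Primrec.fst (Primrec.fst.comp (Primrec.unpair.comp Primrec.snd)))
      (hH.comp Primrec.fst (Primrec.snd.comp (Primrec.unpair.comp Primrec.snd)))
  · simp only [hGR, hHS, mem_appendBox]
    exact ⟨fun ⟨⟨s, hs⟩, ⟨u, hu⟩⟩ => ⟨Nat.pair s u, by simpa using ⟨hs, hu⟩⟩,
      fun ⟨s, hs, hu⟩ => ⟨⟨_, hs⟩, ⟨_, hu⟩⟩⟩

theorem exists' {R : α → β → ProbabilityMeasure Omega → Prop}
    (hR : EffectivelyOpen fun (p : α × β) P => R p.1 p.2 P) :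
    EffectivelyOpen fun a P => ∃ b, R a b P := by
  obtain ⟨G, hG, hGR⟩ := hR
  refine ⟨fun a s => ((Encodable.decode (α := β) s.unpair.1).map
    fun b => G (a, b) s.unpair.2).getD emptyBox, ?_, fun a P => ?_⟩
  · refine Primrec.option_getD.comp (Primrec.option_map
      (Primrec.decode.comp (Primrec.fst.comp (Primrec.unpair.comp Primrec.snd))) ?_)
      (Primrec.const _)
    exact hG.comp (Primrec.pair (Primrec.fst.comp Primrec.fst) Primrec.snd)
      (Primrec.snd.comp (Primrec.unpair.comp (Primrec.snd.comp Primrec.fst)))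
  · constructor
    · rintro ⟨b, hb⟩
      obtain ⟨s, hs⟩ := (hGR (a, b) P).1 hb
      exact ⟨Nat.pair (Encodable.encode b) s, by simpa using hs⟩
    · rintro ⟨s, hs⟩
      cases hd : Encodable.decode (α := β) s.unpair.1 with
      | none => simp [hd, notMem_emptyBox] at hs
      | some b => exact ⟨b, (hGR (a, b) P).2 ⟨s.unpair.2, by simpa [hd] using hs⟩⟩

theorem or {R S : α → ProbabilityMeasure Omega → Prop} (hR : EffectivelyOpen R)
    (hS : EffectivelyOpen S) : EffectivelyOpen fun a P => R a P ∨ S a P := by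
  obtain ⟨G, hG, hGR⟩ := hR
  obtain ⟨H, hH, hHS⟩ := hS
  refine ⟨fun a s => cond s.bodd (G a s.div2) (H a s.div2), ?_, fun a P => ?_⟩
  · exact Primrec.cond (Primrec.nat_bodd.comp Primrec.snd)
      (hG.comp Primrec.fst (Primrec.nat_div2.comp Primrec.snd))
      (hH.comp Primrec.fst (Primrec.nat_div2.comp Primrec.snd))
  · simp only [hGR, hHS]
    constructor
    · rintro (⟨s, hs⟩ | ⟨s, hs⟩)
      · exact ⟨2 * s + 1, by simpa [Nat.div2_val, Nat.mul_add_div] using hs⟩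
      · exact ⟨2 * s, by simpa [Nat.div2_val] using hs⟩
    · rintro ⟨s, hs⟩
      cases hb : s.bodd
      · exact .inr ⟨s.div2, by simpa [hb] using hs⟩
      · exact .inl ⟨s.div2, by simpa [hb] using hs⟩

/-- A bounded intersection is one search over lists `l` that propose a stage for every `i` at once.
-/
theorem forall_lt {R : α → ℕ → ProbabilityMeasure Omega → Prop} {n : α → ℕ} (hn : Primrec n)
    (hR : EffectivelyOpen fun (p : α × ℕ) P => R p.1 p.2 P) :
    EffectivelyOpen fun a P => ∀ i < n a, R a i P := by
  obtain ⟨G, hG, hGR⟩ := hR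
  have key : EffectivelyOpen fun a P => ∃ l : List ℕ,
      P ∈ BoxCode.toSet ((List.range (n a)).flatMap fun i => G (a, i) (l.getD i 0)) := by
    refine exists' (mem_box ?_)
    refine Primrec.list_flatMap (Primrec.list_range.comp (hn.comp Primrec.fst)) ?_
    exact hG.comp (Primrec.pair (Primrec.fst.comp Primrec.fst) Primrec.snd)
      ((Primrec.list_getD 0).comp (Primrec.snd.comp Primrec.fst) Primrec.snd)
  refine key.of_iff fun a P => ?_
  simp only [mem_flatMapBox, List.mem_range]
  constructor
  · intro h
    have h' : ∀ i, ∃ s, i < n a → P ∈ (G (a, i) s).toSet := fun i => by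
      by_cases hi : i < n a
      · obtain ⟨s, hs⟩ := (hGR (a, i) P).1 (h i hi)
        exact ⟨s, fun _ => hs⟩
      · exact ⟨0, fun hi' => absurd hi' hi⟩
    choose s hs using h'
    refine ⟨(List.range (n a)).map s, fun i hi => ?_⟩
    have : ((List.range (n a)).map s).getD i 0 = s i := by
      simp [List.getD_eq_getElem?_getD, hi]
    rw [this]
    exact hs i hi
  · rintro ⟨l, hl⟩ i hi
    exact (hGR (a, i) P).2 ⟨_, hl i hi⟩

/-- A box condition is two-sided; the upper bound `2` always holds. The lower bound `-1` plays the
same role in `measure_lt`. -/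
theorem lt_measure {r : α → RatCode} {x : α → Word} (hr : Primrec r) (hx : Primrec x) :
    EffectivelyOpen fun a P => ((r a).val : ℝ) < (P : Measure Omega).real (cyl (x a)) := by
  refine (mem_box (f := fun a => [(x a, r a, ((2 : ℤ), 0))]) ?_).of_iff fun a P => ?_
  · exact Primrec.list_cons.comp (hx.pair (hr.pair (Primrec.const _))) (Primrec.const _)
  · have h2 : (P : Measure Omega).real (cyl (x a)) < 2 :=
      lt_of_le_of_lt measureReal_le_one (by norm_num)
    simpa [BoxCode.toSet, RatCode.val] using fun _ => h2

theorem measure_lt {r : α → RatCode} {x : α → Word} (hr : Primrec r) (hx : Primrec x) :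
    EffectivelyOpen fun a P => (P : Measure Omega).real (cyl (x a)) < ((r a).val : ℝ) := by
  refine (mem_box (f := fun a => [(x a, ((-1 : ℤ), 0), r a)]) ?_).of_iff fun a P => ?_
  · exact Primrec.list_cons.comp (hx.pair ((Primrec.const _).pair hr)) (Primrec.const _)
  · have h2 : -1 < (P : Measure Omega).real (cyl (x a)) :=
      lt_of_lt_of_le (by norm_num) measureReal_nonneg
    simpa [BoxCode.toSet, RatCode.val] using fun _ => h2

end EffectivelyOpen

/-! ### Lower semicomputability in terms of effectively open relations -/

theorem ratLT_of_neg {r : ℚ} (hr : r < 0) (a : ℝ≥0∞) : RatLT r a := by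
  have h1 : ((r : ℝ) : EReal) < 0 := by exact_mod_cast hr
  exact lt_of_lt_of_le h1 (EReal.coe_ennreal_nonneg a)

theorem ratLT_iff_of_nonneg {r : ℚ} (hr : 0 ≤ r) {a : ℝ≥0∞} :
    RatLT r a ↔ ENNReal.ofReal r < a := by
  have h0 : (0 : ℝ) ≤ (r : ℝ) := by exact_mod_cast hr
  have : ((r : ℝ) : EReal) = ((ENNReal.ofReal (r : ℝ) : ℝ≥0∞) : EReal) := by
    rw [EReal.coe_ennreal_ofReal, max_eq_left h0]
  rw [RatLT, this, EReal.coe_ennreal_lt_coe_ennreal_iff]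

/-- `ENNReal.ofReal` sends negative rationals to `0`, which loses the strict inequality at `a = 0`;
hence the separate case `r < 0` here and in later arguments. -/
theorem ratLT_iff {r : ℚ} {a : ℝ≥0∞} : RatLT r a ↔ r < 0 ∨ ENNReal.ofReal r < a := by
  rcases lt_or_ge r 0 with h | h
  · simp [h, ratLT_of_neg h a]
  · simp [ratLT_iff_of_nonneg h, not_lt.2 h]

/-- Lower semicomputability of a function of a finite object and a measure. -/
def LowerFunction {α : Type*} [Primcodable α] (F : α → ProbabilityMeasure Omega → ℝ≥0∞) :
    Prop :=
  EffectivelyOpen fun (p : RatCode × α) P => RatLT p.1.val (F p.2 P)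

theorem exists_rePred_of_lowerFunction {F : Word → ProbabilityMeasure Omega → ℝ≥0∞}
    (hF : LowerFunction F) : ∃ A : RatCode × Word × BoxCode → Prop, REPred A ∧
      ∀ (r : RatCode) (x : Word) (P : ProbabilityMeasure Omega),
        RatLT r.val (F x P) ↔ ∃ β : BoxCode, A (r, x, β) ∧ P ∈ β.toSet := by
  obtain ⟨G, hG, hGR⟩ := hF
  refine ⟨fun a => ∃ s, decide (G (a.1, a.2.1) s = a.2.2) = true, rePred_of_primrec ?_,
    fun r x P => ?_⟩
  · exact PrimrecPred.decide <| Primrec.eq.comp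
      (hG.comp (Primrec.pair (Primrec.fst.comp Primrec.fst)
        (Primrec.fst.comp (Primrec.snd.comp Primrec.fst))) Primrec.snd)
      (Primrec.snd.comp (Primrec.snd.comp Primrec.fst))
  · refine (hGR (r, x) P).trans ?_
    simp only [decide_eq_true_eq]
    exact ⟨fun ⟨s, hs⟩ => ⟨_, ⟨s, rfl⟩, hs⟩, fun ⟨_, ⟨s, rfl⟩, h⟩ => ⟨s, h⟩⟩

theorem lowerSemicomputableOnWords_iff {f : Word → ProbabilityMeasure Omega → ℝ≥0∞} :
    LowerSemicomputableOnWords f ↔ LowerFunction f := by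
  refine ⟨fun ⟨A, hA, h⟩ => ?_, exists_rePred_of_lowerFunction⟩
  have hAe := EffectivelyOpen.of_rePred hA
  have hkey : EffectivelyOpen fun (p : RatCode × Word) P =>
      ∃ β : BoxCode, A (p.1, p.2, β) ∧ P ∈ β.toSet :=
    EffectivelyOpen.exists' (EffectivelyOpen.and
      (hAe.comp (f := fun q : (RatCode × Word) × BoxCode => (q.1.1, q.1.2, q.2))
        ((Primrec.fst.comp Primrec.fst).pair
          ((Primrec.snd.comp Primrec.fst).pair Primrec.snd)))
      (EffectivelyOpen.mem_box Primrec.snd))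
  exact hkey.of_iff fun p P => h p.1 p.2 P

theorem lowerSemicomputable_of_words {F : Word → ProbabilityMeasure Omega → ℝ≥0∞}
    (hF : LowerFunction F) {t : Omega → ProbabilityMeasure Omega → ℝ≥0∞}
    (ht : ∀ (r : RatCode) ω P, RatLT r.val (t ω P) ↔ ∃ x, ω ∈ cyl x ∧ RatLT r.val (F x P)) :
    LowerSemicomputable t := by
  obtain ⟨A, hA, h⟩ := exists_rePred_of_lowerFunction hF
  refine ⟨A, hA, fun r ω P => ?_⟩
  rw [ht]
  simp only [h]
  exact ⟨fun ⟨x, hx, β, hβ, hP⟩ => ⟨x, β, hβ, hx, hP⟩,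
    fun ⟨x, β, hβ, hx, hP⟩ => ⟨x, hx, β, hβ, hP⟩⟩

/-! ### Initial segments and cylinders -/

/-- The initial segment of length `n` of a sequence. -/
def initialWord (ω : Omega) (n : ℕ) : Word := (List.range n).map ω

@[simp] theorem length_initialWord (ω : Omega) (n : ℕ) : (initialWord ω n).length = n := by
  simp [initialWord]

theorem isInitial_initialWord (ω : Omega) (n : ℕ) : IsInitial (initialWord ω n) ω := by
  intro i h
  simp [initialWord]

theorem initialWord_length {x : Word} {ω : Omega} (h : IsInitial x ω) :
    initialWord ω x.length = x := by
  refine List.ext_getElem (by simp) fun i h1 h2 => ?_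
  simp [initialWord, h i h2]

theorem take_initialWord (ω : Omega) {j n : ℕ} (h : j ≤ n) :
    (initialWord ω n).take j = initialWord ω j := by
  rw [initialWord, ← List.map_take, List.take_range, min_eq_left h, initialWord]

theorem isPrefix_initialWord_iff {x : Word} {ω : Omega} {n : ℕ} :
    x <+: initialWord ω n ↔ x.length ≤ n ∧ IsInitial x ω := by
  rw [List.prefix_iff_eq_take]
  constructor
  · intro h
    have hl : x.length ≤ n := by
      have := congrArg List.length h
      simp at this
      omega
    rw [take_initialWord ω hl] at h
    exact ⟨hl, h ▸ isInitial_initialWord ω _⟩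
  · rintro ⟨hl, h⟩
    rw [take_initialWord ω hl, initialWord_length h]

theorem dropLast_initialWord (ω : Omega) (n : ℕ) :
    (initialWord ω n).dropLast = initialWord ω (n - 1) := by
  rw [List.dropLast_eq_take, length_initialWord, take_initialWord ω (Nat.sub_le n 1)]

/-- The initial segments of a sequence correspond to their lengths. -/
def initialEquiv (ω : Omega) : ℕ ≃ {x : Word // IsInitial x ω} where
  toFun n := ⟨initialWord ω n, isInitial_initialWord ω n⟩
  invFun x := x.1.length
  left_inv n := by simp
  right_inv x := Subtype.ext (initialWord_length x.2)

theorem tsum_initial (ω : Omega) (g : Word → ℝ≥0∞) :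
    ∑' x : {x : Word // IsInitial x ω}, g x = ∑' n, g (initialWord ω n) :=
  ((initialEquiv ω).tsum_eq fun x : {x : Word // IsInitial x ω} => g x).symm

theorem measurableSet_cyl (x : Word) : MeasurableSet (cyl x) := by
  have : cyl x = ⋂ (i : ℕ) (h : i < x.length), (fun ω : Omega => ω i) ⁻¹' {x[i]} := by
    ext ω
    simp [cyl, IsInitial]
  rw [this]
  exact MeasurableSet.iInter fun i => MeasurableSet.iInter fun h =>
    measurable_pi_apply i (measurableSet_singleton _)

/-- Tonelli, after the sum over prefixes is written as a sum of indicators of cylinders. -/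
theorem lintegral_tsum_initial (μ : Measure Omega) (g : Word → ℝ≥0∞) :
    ∫⁻ ω, ∑' x : {x : Word // IsInitial x ω}, g x ∂μ = ∑' x, g x * μ (cyl x) := by
  have h : ∀ ω, ∑' x : {x : Word // IsInitial x ω}, g x =
      ∑' x, (cyl x).indicator (fun _ => g x) ω := fun ω => by
    refine (tsum_subtype {x : Word | IsInitial x ω} g).trans (tsum_congr fun x => ?_)
    by_cases hx : IsInitial x ω
    · rw [Set.indicator_of_mem (show x ∈ {x : Word | IsInitial x ω} from hx),
        Set.indicator_of_mem (show ω ∈ cyl x from hx)]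
    · rw [Set.indicator_of_notMem (show x ∉ {x : Word | IsInitial x ω} from hx),
        Set.indicator_of_notMem (show ω ∉ cyl x from hx)]
  simp only [h]
  rw [lintegral_tsum fun x => (measurable_const.indicator (measurableSet_cyl x)).aemeasurable]
  exact tsum_congr fun x => lintegral_indicator_const (measurableSet_cyl x) _

/-! ### Closure properties of lower semicomputable functions -/

theorem exists_ratCode_btwn {a : ℝ} {b : ℝ≥0∞} (ha : 0 ≤ a) (h : ENNReal.ofReal a < b) :
    ∃ q : RatCode, a < (q.val : ℝ) ∧ RatLT q.val b := by
  obtain ⟨c, hac, hcb⟩ := exists_between h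
  have hc : c ≠ ∞ := ne_top_of_lt hcb
  have hac' : a < c.toReal := (ENNReal.ofReal_lt_iff_lt_toReal ha hc).1 hac
  obtain ⟨q, h1, h2⟩ := RatCode.exists_val_btwn hac'
  refine ⟨q, h1, ?_⟩
  have hq : 0 ≤ q.val := by exact_mod_cast ha.trans h1.le
  rw [ratLT_iff_of_nonneg hq]
  exact lt_of_le_of_lt (ENNReal.ofReal_le_of_le_toReal h2.le) hcb

/-- A term `a j = 0` exceeds no nonnegative rational, so values `q j ≤ 0` are admitted
unconditionally. Terms may be infinite, which forces the case distinctions. -/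
theorem exists_ratCode_sum_gt (a : ℕ → ℝ≥0∞) (n : ℕ) : ∀ r : ℝ, 0 ≤ r →
    ENNReal.ofReal r < ∑ j ∈ Finset.range n, a j →
    ∃ q : ℕ → RatCode, (∀ j, ¬ 0 < (q j).val ∨ RatLT (q j).val (a j)) ∧
      r < ∑ j ∈ Finset.range n, ((q j).val : ℝ) := by
  induction n with
  | zero => intro r _ h; simp at h
  | succ n ih =>
    intro r hr h
    rw [Finset.sum_range_succ] at h
    set S := ∑ j ∈ Finset.range n, a j with hS
    have upd : ∀ (q : ℕ → RatCode) (c : RatCode),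
        ∑ j ∈ Finset.range (n + 1), ((Function.update q n c j).val : ℝ) =
          ∑ j ∈ Finset.range n, ((q j).val : ℝ) + c.val := fun q c => by
      rw [Finset.sum_range_succ, Function.update_self]
      congr 1
      refine Finset.sum_congr rfl fun j hj => ?_
      rw [Function.update_of_ne (Finset.mem_range.1 hj).ne]
    have updP : ∀ (q : ℕ → RatCode) (c : RatCode),
        (∀ j, ¬ 0 < (q j).val ∨ RatLT (q j).val (a j)) →
        (¬ 0 < c.val ∨ RatLT c.val (a n)) →
        ∀ j, ¬ 0 < (Function.update q n c j).val ∨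
          RatLT (Function.update q n c j).val (a j) := fun q c hq hc j => by
      by_cases hj : j = n
      · subst hj; simpa using hc
      · simpa [Function.update_of_ne hj] using hq j
    rcases lt_or_ge (ENNReal.ofReal r) S with hrS | hrS
    · obtain ⟨q, hq, hsum⟩ := ih r hr hrS
      refine ⟨Function.update q n (0, 0), updP q _ hq (.inl (by simp [RatCode.val_zero])), ?_⟩
      rw [upd, RatCode.val_zero]
      simpa using hsum
    -- The first `n` terms do not exceed `r`, so the last one must supply more than `r - S`. If its
    -- approximation `c` passes `r` alone, zeros suffice elsewhere; otherwise induction applies to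
    -- `r - c`.
    · have hSt : S ≠ ∞ := ne_top_of_le_ne_top ENNReal.ofReal_ne_top hrS
      have hSr : S.toReal ≤ r := ENNReal.toReal_le_of_le_ofReal hr hrS
      have hd : ENNReal.ofReal (r - S.toReal) < a n := by
        rw [ENNReal.ofReal_sub r ENNReal.toReal_nonneg, ENNReal.ofReal_toReal hSt]
        refine ENNReal.sub_lt_of_lt_add hrS ?_
        rwa [add_comm]
      obtain ⟨c, hc1, hc2⟩ := exists_ratCode_btwn (sub_nonneg.2 hSr) hd
      rcases lt_or_ge r c.val with hrc | hrc
      · refine ⟨Function.update (fun _ => (0, 0)) n c,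
          updP _ _ (fun j => .inl (by simp [RatCode.val_zero])) (.inr hc2), ?_⟩
        rw [upd]
        simpa [RatCode.val_zero] using hrc
      · obtain ⟨q, hq, hsum⟩ := ih (r - c.val) (sub_nonneg.2 hrc) (by
          rw [ENNReal.ofReal_lt_iff_lt_toReal (sub_nonneg.2 hrc) hSt]
          linarith)
        refine ⟨Function.update q n c, updP q _ hq (.inr hc2), ?_⟩
        rw [upd]
        linarith

namespace LowerFunction

variable {α β : Type*} [Primcodable α] [Primcodable β]

theorem ratLT {F : α → ProbabilityMeasure Omega → ℝ≥0∞} (hF : LowerFunction F) {r : β → RatCode}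
    {f : β → α} (hr : Primrec r) (hf : Primrec f) :
    EffectivelyOpen fun b P => RatLT (r b).val (F (f b) P) :=
  EffectivelyOpen.comp hF (hr.pair hf)

theorem comp {F : α → ProbabilityMeasure Omega → ℝ≥0∞} (hF : LowerFunction F) {f : β → α}
    (hf : Primrec f) : LowerFunction fun b P => F (f b) P :=
  hF.ratLT Primrec.fst (hf.comp Primrec.snd)

theorem sum {F : α → ℕ → ProbabilityMeasure Omega → ℝ≥0∞}
    (hF : LowerFunction fun (p : α × ℕ) P => F p.1 p.2 P) {n : α → ℕ} (hn : Primrec n) :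
    LowerFunction fun a P => ∑ j ∈ Finset.range (n a), F a j P := by
  have hget : Primrec fun z : ((RatCode × α) × List RatCode) × ℕ =>
      (z.1.2.getD z.2 (0, 0) : RatCode) :=
    (Primrec.list_getD (0, 0)).comp (Primrec.snd.comp Primrec.fst) Primrec.snd
  have hfold : Primrec fun l : List RatCode => l.foldr RatCode.add (0, 0) :=
    Primrec.list_foldr (h := fun _ c => RatCode.add c.1 c.2) Primrec.id (Primrec.const _)
      (RatCode.primrec_add.comp (Primrec.fst.comp Primrec.snd) (Primrec.snd.comp Primrec.snd))
  have key : EffectivelyOpen fun (p : RatCode × α) P => p.1.val < 0 ∨ ∃ l : List RatCode,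
      (l.length = n p.2 ∧ p.1.val < (l.foldr RatCode.add (0, 0)).val) ∧
      ∀ j < n p.2, ¬ 0 < (l.getD j (0, 0)).val ∨
        RatLT (l.getD j (0, 0)).val (F p.2 j P) := by
    refine EffectivelyOpen.or
      (.of_primrecPred (RatCode.primrec_neg_iff.comp Primrec.fst)) (.exists' (.and ?_ ?_))
    · refine .of_primrecPred (.and ?_ ?_)
      · exact Primrec.eq.comp (Primrec.list_length.comp Primrec.snd)
          (hn.comp (Primrec.snd.comp Primrec.fst))
      · exact RatCode.primrec_lt.comp (Primrec.fst.comp Primrec.fst) (hfold.comp Primrec.snd)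
    · refine .forall_lt (hn.comp (Primrec.snd.comp Primrec.fst)) (.or ?_ ?_)
      · exact .of_primrecPred (RatCode.primrec_pos_iff.comp hget).not
      · exact hF.ratLT hget
          ((Primrec.snd.comp (Primrec.fst.comp Primrec.fst)).pair Primrec.snd)
  have hsum : ∀ l : List RatCode, (l.foldr RatCode.add (0, 0)).val =
      ∑ j ∈ Finset.range l.length, (l.getD j (0, 0)).val := by
    intro l
    induction l with
    | nil => simp [RatCode.val_zero]
    | cons c l ih =>
      rw [List.foldr_cons, RatCode.val_add, ih, List.length_cons, Finset.sum_range_succ']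
      simp [add_comm]
  refine key.of_iff fun p P => ?_
  rcases lt_or_ge p.1.val 0 with hneg | hnn
  · simp [hneg, ratLT_of_neg hneg]
  simp only [not_lt.2 hnn, false_or, ratLT_iff_of_nonneg hnn]
  constructor
  · intro h
    obtain ⟨q, hq, hlt⟩ := exists_ratCode_sum_gt (fun j => F p.2 j P) (n p.2) _
      (by exact_mod_cast hnn) h
    have hg : ∀ j < n p.2, ((List.range (n p.2)).map q).getD j (0, 0) = q j := fun j hj => by
      simp [List.getD_eq_getElem?_getD, hj]
    refine ⟨(List.range (n p.2)).map q, ⟨by simp, ?_⟩, fun j hj => ?_⟩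
    · rw [hsum, List.length_map, List.length_range,
        Finset.sum_congr rfl fun j hj => by rw [hg j (Finset.mem_range.1 hj)]]
      exact_mod_cast hlt
    · rw [hg j hj]
      exact hq j
  · rintro ⟨l, ⟨hl, hlt⟩, h⟩
    rw [hsum, hl] at hlt
    have hlt' : ((p.1.val : ℚ) : ℝ) <
        ∑ j ∈ Finset.range (n p.2), ((l.getD j (0, 0)).val : ℝ) := by exact_mod_cast hlt
    -- `ENNReal.ofReal` is additive on nonnegative summands only, so entries are replaced by their
    -- positive parts.
    calc ENNReal.ofReal p.1.val
        < ENNReal.ofReal (∑ j ∈ Finset.range (n p.2), max ((l.getD j (0, 0)).val : ℝ) 0) := by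
          refine (ENNReal.ofReal_lt_ofReal_iff_of_nonneg (by exact_mod_cast hnn)).2 ?_
          exact hlt'.trans_le (Finset.sum_le_sum fun j _ => le_max_left _ _)
      _ = ∑ j ∈ Finset.range (n p.2), ENNReal.ofReal (max ((l.getD j (0, 0)).val : ℝ) 0) :=
          ENNReal.ofReal_sum_of_nonneg fun j _ => le_max_right _ _
      _ ≤ ∑ j ∈ Finset.range (n p.2), F p.2 j P := by
          refine Finset.sum_le_sum fun j hj => ?_
          rcases h j (Finset.mem_range.1 hj) with hj' | hj'
          · rw [max_eq_right (by exact_mod_cast not_lt.1 hj')]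
            simp
          · rcases ratLT_iff.1 hj' with h0 | h0
            · rw [max_eq_right (by exact_mod_cast h0.le)]
              simp
            · rcases le_total ((l.getD j (0, 0)).val : ℝ) 0 with h1 | h1
              · rw [max_eq_right h1]
                simp
              · rw [max_eq_left h1]
                exact h0.le

/-- A quotient exceeds `r ≥ 0` exactly when `r * b < c` for some `c` below the numerator and `b`
above the denominator. This remains correct when `P(x) = 0`. -/
theorem div_measure {F : α → ProbabilityMeasure Omega → ℝ≥0∞} (hF : LowerFunction F)
    {x : α → Word} (hx : Primrec x) :
    LowerFunction fun a P => F a P / (P : Measure Omega) (cyl (x a)) := by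
  have key : EffectivelyOpen fun (p : RatCode × α) P => p.1.val < 0 ∨ ∃ c b : RatCode,
      (RatCode.mul p.1 b).val < c.val ∧ RatLT c.val (F p.2 P) ∧
        (P : Measure Omega).real (cyl (x p.2)) < b.val := by
    refine EffectivelyOpen.or
      (.of_primrecPred (RatCode.primrec_neg_iff.comp Primrec.fst))
      (.exists' (.exists' (.and ?_ (.and ?_ ?_))))
    · exact .of_primrecPred (RatCode.primrec_lt.comp
        (RatCode.primrec_mul.comp (Primrec.fst.comp (Primrec.fst.comp Primrec.fst)) Primrec.snd)
        (Primrec.snd.comp Primrec.fst))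
    · exact hF.ratLT (Primrec.snd.comp Primrec.fst)
        (Primrec.snd.comp (Primrec.fst.comp Primrec.fst))
    · exact .measure_lt Primrec.snd (hx.comp (Primrec.snd.comp (Primrec.fst.comp Primrec.fst)))
  refine key.of_iff fun p P => ?_
  rcases lt_or_ge p.1.val 0 with hneg | hnn
  · simp [hneg, ratLT_of_neg hneg]
  have hr : (0 : ℝ) ≤ p.1.val := by exact_mod_cast hnn
  set μ := (P : Measure Omega).real (cyl (x p.2)) with hμ
  have hμ0 : 0 ≤ μ := measureReal_nonneg
  have hiff : RatLT p.1.val (F p.2 P / (P : Measure Omega) (cyl (x p.2))) ↔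
      ENNReal.ofReal (p.1.val * μ) < F p.2 P := by
    rw [ratLT_iff_of_nonneg hnn, ENNReal.lt_div_iff_mul_lt (.inr ENNReal.ofReal_ne_top)
      (.inl (measure_ne_top _ _)), ENNReal.ofReal_mul hr, hμ, ofReal_measureReal]
  simp only [not_lt.2 hnn, false_or, hiff]
  constructor
  · intro h
    obtain ⟨c, hc1, hc2⟩ := exists_ratCode_btwn (mul_nonneg hr hμ0) h
    have : ∃ b : ℝ, μ < b ∧ p.1.val * b < c.val := by
      -- Multiplied by `r`, the added term stays below the gap `c - r * μ`; the `+ 1` covers `r =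
      -- 0`.
      refine ⟨μ + (c.val - p.1.val * μ) / (p.1.val + 1), ?_, ?_⟩
      · have := div_pos (sub_pos.2 hc1) (by linarith : (0 : ℝ) < p.1.val + 1)
        linarith
      · have h1 : (p.1.val : ℝ) * ((c.val - p.1.val * μ) / (p.1.val + 1)) <
            c.val - p.1.val * μ := by
          rw [← mul_div_assoc, div_lt_iff₀ (by linarith)]
          nlinarith
        linarith
    obtain ⟨b, hb1, hb2⟩ := this
    obtain ⟨b', hb'1, hb'2⟩ := RatCode.exists_val_btwn hb1
    refine ⟨c, b', ?_, hc2, hb'1⟩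
    rw [RatCode.val_mul]
    have : (p.1.val : ℝ) * b'.val < c.val :=
      (mul_le_mul_of_nonneg_left hb'2.le hr).trans_lt hb2
    exact_mod_cast this
  · rintro ⟨c, b, h1, h2, h3⟩
    rw [RatCode.val_mul] at h1
    have h1' : (p.1.val : ℝ) * b.val < c.val := by exact_mod_cast h1
    have h4 : (p.1.val : ℝ) * μ < c.val := (mul_le_mul_of_nonneg_left h3.le hr).trans_lt h1'
    have hc : 0 ≤ c.val := by exact_mod_cast (mul_nonneg hr hμ0).trans h4.le
    rw [ratLT_iff_of_nonneg hc] at h2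
    exact (ENNReal.ofReal_le_ofReal h4.le).trans_lt h2

end LowerFunction

/-! ### The sum over initial segments is a uniform test -/

/-- The sum of `m(y | P) / P(y)` over all prefixes `y` of a word. -/
noncomputable def prefixSum (m : Word → ProbabilityMeasure Omega → ℝ≥0∞) (x : Word)
    (P : ProbabilityMeasure Omega) : ℝ≥0∞ :=
  ∑ j ∈ Finset.range (x.length + 1), m (x.take j) P / (P : Measure Omega) (cyl (x.take j))

theorem prefixSum_initialWord (m : Word → ProbabilityMeasure Omega → ℝ≥0∞) (ω : Omega) (n : ℕ)
    (P : ProbabilityMeasure Omega) : prefixSum m (initialWord ω n) P =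
      ∑ j ∈ Finset.range (n + 1),
        m (initialWord ω j) P / (P : Measure Omega) (cyl (initialWord ω j)) := by
  rw [prefixSum, length_initialWord]
  refine Finset.sum_congr rfl fun j hj => ?_
  rw [take_initialWord ω (Nat.lt_succ_iff.1 (Finset.mem_range.1 hj))]

theorem initialSum_eq_iSup (m : Word → ProbabilityMeasure Omega → ℝ≥0∞) (ω : Omega)
    (P : ProbabilityMeasure Omega) :
    initialSum m ω P = ⨆ n, prefixSum m (initialWord ω n) P := by
  rw [initialSum, tsum_initial ω fun x => m x P / (P : Measure Omega) (cyl x),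
    ENNReal.tsum_eq_iSup_nat]
  simp only [prefixSum_initialWord]
  -- A prefix of length `n` contributes `n + 1` terms, so the two families of partial sums are
  -- shifted by one.
  refine le_antisymm (iSup_le fun n => le_iSup_of_le n ?_)
    (iSup_le fun n => le_iSup_of_le (n + 1) le_rfl)
  exact Finset.sum_le_sum_of_subset (Finset.range_subset_range.2 n.le_succ)

theorem isUniformTest_initialSum {m : Word → ProbabilityMeasure Omega → ℝ≥0∞}
    (hm : IsUniformSemimeasure m) : IsUniformTest (initialSum m) where
  lowerSemicomputable := by
    have hm' := lowerSemicomputableOnWords_iff.1 hm.lowerSemicomputable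
    have htake : Primrec fun p : Word × ℕ => p.1.take p.2 :=
      Primrec.list_take.comp Primrec.snd Primrec.fst
    have hF : LowerFunction (prefixSum m) :=
      LowerFunction.sum (F := fun x j P => m (x.take j) P / (P : Measure Omega) (cyl (x.take j)))
        ((hm'.comp htake).div_measure htake) (Primrec.succ.comp Primrec.list_length)
    refine lowerSemicomputable_of_words hF fun r ω P => ?_
    have hex : (∃ x, ω ∈ cyl x ∧ RatLT r.val (prefixSum m x P)) ↔
        ∃ n, RatLT r.val (prefixSum m (initialWord ω n) P) :=
      ⟨fun ⟨x, hx, h⟩ => ⟨x.length, by rwa [initialWord_length hx]⟩,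
        fun ⟨n, h⟩ => ⟨_, isInitial_initialWord ω n, h⟩⟩
    rw [hex, initialSum_eq_iSup]
    rcases lt_or_ge r.val 0 with hneg | hnn
    · simp [ratLT_of_neg hneg]
    · simp only [ratLT_iff_of_nonneg hnn, lt_iSup_iff]
  lintegral_le_one P := by
    refine le_trans (le_of_eq (lintegral_tsum_initial (P : Measure Omega)
      fun x => m x P / (P : Measure Omega) (cyl x))) ((ENNReal.tsum_le_tsum fun x => ?_).trans
        (hm.tsum_le_one P))
    -- Only an inequality holds: on a null cylinder the product is `0`, whatever `m` is.
    rw [mul_comm]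
    exact ENNReal.mul_div_le

/-! ### Continuous approximations of the indicator functions of basic open sets -/

/-- How far a measure is from violating the condition `u < P(y) < v`. -/
noncomputable def slack (e : Word × RatCode × RatCode) (P : ProbabilityMeasure Omega) : ℝ :=
  min ((P : Measure Omega).real (cyl e.1) - e.2.1.val)
    (e.2.2.val - (P : Measure Omega).real (cyl e.1))

/-- A continuous function of the measure, supported by the basic open set `β` and
increasing with `N` to the value `r` on it. -/
noncomputable def hat (r : RatCode) (N : ℕ) (P : ProbabilityMeasure Omega) : BoxCode → ℝ≥0
  | [] => (r.val : ℝ).toNNReal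
  | e :: β => min (((N : ℝ) + 1) * slack e P).toNNReal (hat r N P β)

theorem mem_toSet_iff_slack {β : BoxCode} {P : ProbabilityMeasure Omega} :
    P ∈ β.toSet ↔ ∀ e ∈ β, 0 < slack e P := by
  simp only [BoxCode.toSet, slack, lt_min_iff, sub_pos]
  rfl

/-- Here and in `hat_lt_iff` a comparison becomes finitely many strict conditions on `P`. For an
indicator the upper comparison would describe the complement of a box, which need not be open. -/
theorem lt_hat_iff {q : ℝ} (hq : 0 ≤ q) {r : RatCode} {N : ℕ} {P : ProbabilityMeasure Omega}
    {β : BoxCode} :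
    q < hat r N P β ↔ q < r.val ∧ ∀ e ∈ β, q / ((N : ℝ) + 1) < slack e P := by
  have hN : (0 : ℝ) < (N : ℝ) + 1 := by positivity
  have aux : ∀ a : ℝ, q < (a.toNNReal : ℝ) ↔ q < a := fun a => by
    rw [Real.coe_toNNReal', lt_max_iff, or_iff_left (not_lt.2 hq)]
  induction β with
  | nil => simpa [hat] using aux r.val
  | cons e β ih =>
    rw [hat, NNReal.coe_min, lt_min_iff, show _ ↔ _ from ih, aux, List.forall_mem_cons, div_lt_iff₀' hN]
    tauto

theorem hat_lt_iff {s : ℝ} {r : RatCode} {N : ℕ} {P : ProbabilityMeasure Omega}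
    {β : BoxCode} :
    hat r N P β < s ↔ 0 < s ∧ (r.val < s ∨ ∃ e ∈ β, slack e P < s / ((N : ℝ) + 1)) := by
  have hN : (0 : ℝ) < (N : ℝ) + 1 := by positivity
  have aux : ∀ a : ℝ, (a.toNNReal : ℝ) < s ↔ 0 < s ∧ a < s := fun a => by
    rw [Real.coe_toNNReal', max_lt_iff, and_comm]
  induction β with
  | nil => simpa [hat] using aux r.val
  | cons e β ih =>
    rw [hat, NNReal.coe_min, min_lt_iff, show _ ↔ _ from ih, aux, ← lt_div_iff₀' hN]
    simp only [List.mem_cons, exists_eq_or_imp]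
    tauto

theorem hat_le (r : RatCode) (N : ℕ) (P : ProbabilityMeasure Omega) (β : BoxCode) :
    hat r N P β ≤ (r.val : ℝ).toNNReal := by
  induction β with
  | nil => exact le_rfl
  | cons e β ih => exact (min_le_right _ _).trans ih

theorem mem_toSet_of_hat_pos {r : RatCode} {N : ℕ} {P : ProbabilityMeasure Omega}
    {β : BoxCode} (h : 0 < hat r N P β) : P ∈ β.toSet := by
  have := ((lt_hat_iff le_rfl).1 (NNReal.coe_pos.2 h)).2
  simpa [mem_toSet_iff_slack] using this

theorem eventually_le_hat (r : RatCode) {P : ProbabilityMeasure Omega} {β : BoxCode}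
    (h : P ∈ β.toSet) : ∀ᶠ N in Filter.atTop, (r.val : ℝ).toNNReal ≤ hat r N P β := by
  rw [mem_toSet_iff_slack] at h
  induction β with
  | nil => exact Filter.Eventually.of_forall fun _ => le_rfl
  | cons e β ih =>
    rw [List.forall_mem_cons] at h
    have h1 : Filter.Tendsto (fun N : ℕ => ((N : ℝ) + 1) * slack e P) Filter.atTop
        Filter.atTop :=
      (Filter.tendsto_atTop_add_const_right _ _ tendsto_natCast_atTop_atTop).atTop_mul_const h.1
    filter_upwards [ih h.2, h1.eventually_ge_atTop (r.val : ℝ)] with N hN1 hN2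
    exact le_min (Real.toNNReal_le_toNNReal hN2) hN1

namespace EffectivelyOpen

variable {α : Type*} [Primcodable α]

theorem lt_hat {q r : α → RatCode} {N : α → ℕ} {β : α → BoxCode} (hq : Primrec q)
    (hr : Primrec r) (hN : Primrec N) (hβ : Primrec β) :
    EffectivelyOpen fun a P => ((q a).val : ℝ) < hat (r a) (N a) P (β a) := by
  have hδ := RatCode.primrec_divSucc.comp hq hN
  -- The condition `q / (N + 1) < slack` narrows each interval `(u, v)` by that amount on both
  -- sides, so it is again a box.
  have key : EffectivelyOpen fun a P => (q a).val < 0 ∨ ((q a).val < (r a).val ∧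
      P ∈ BoxCode.toSet ((β a).map fun e =>
        (e.1, e.2.1.add ((q a).divSucc (N a)), e.2.2.add ((q a).divSucc (N a)).neg))) := by
    refine .or (.of_primrecPred (RatCode.primrec_neg_iff.comp hq))
      (.and (.of_primrecPred (RatCode.primrec_lt.comp hq hr)) (.mem_box ?_))
    exact Primrec.list_map hβ (Primrec.pair (Primrec.fst.comp Primrec.snd) (Primrec.pair
      (RatCode.primrec_add.comp (Primrec.fst.comp (Primrec.snd.comp Primrec.snd))
        (hδ.comp Primrec.fst))
      (RatCode.primrec_add.comp (Primrec.snd.comp (Primrec.snd.comp Primrec.snd))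
        (RatCode.primrec_neg.comp (hδ.comp Primrec.fst))))).to₂
  refine key.of_iff fun a P => ?_
  rcases lt_or_ge (q a).val 0 with hneg | hnn
  · have : ((q a).val : ℝ) < hat (r a) (N a) P (β a) :=
      lt_of_lt_of_le (by exact_mod_cast hneg) (NNReal.coe_nonneg _)
    simp [hneg, this]
  · rw [lt_hat_iff (by exact_mod_cast hnn), mem_toSet_iff_slack, List.forall_mem_map]
    simp only [not_lt.2 hnn, false_or, Rat.cast_lt]
    refine and_congr_right fun _ => forall₂_congr fun e _ => ?_
    simp only [slack, lt_min_iff, RatCode.val_add, RatCode.val_neg, RatCode.val_divSucc]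
    push_cast
    constructor <;> rintro ⟨h1, h2⟩ <;> constructor <;> linarith

theorem hat_lt {s r : α → RatCode} {N : α → ℕ} {β : α → BoxCode} (hs : Primrec s)
    (hr : Primrec r) (hN : Primrec N) (hβ : Primrec β) :
    EffectivelyOpen fun a P => (hat (r a) (N a) P (β a) : ℝ) < (s a).val := by
  have hδ := RatCode.primrec_divSucc.comp hs hN
  have hmem : PrimrecRel fun (e : Word × RatCode × RatCode) (l : BoxCode) =>
      ∃ e' ∈ l, e' = e := (PrimrecRel.exists_mem_list Primrec.eq).swap
  have key : EffectivelyOpen fun a P => 0 < (s a).val ∧ ((r a).val < (s a).val ∨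
      ∃ e : Word × RatCode × RatCode, (∃ e' ∈ β a, e' = e) ∧
        ((P : Measure Omega).real (cyl e.1) < (e.2.1.add ((s a).divSucc (N a))).val ∨
          (e.2.2.add ((s a).divSucc (N a)).neg).val < (P : Measure Omega).real (cyl e.1))) := by
    refine .and (.of_primrecPred (RatCode.primrec_pos_iff.comp hs))
      (.or (.of_primrecPred (RatCode.primrec_lt.comp hr hs)) (.exists' (.and ?_ (.or ?_ ?_))))
    · exact .of_primrecPred (hmem.comp Primrec.snd (hβ.comp Primrec.fst))
    · exact .measure_lt (RatCode.primrec_add.comp (Primrec.fst.comp (Primrec.snd.comp Primrec.snd))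
        (hδ.comp Primrec.fst)) (Primrec.fst.comp Primrec.snd)
    · exact .lt_measure (RatCode.primrec_add.comp (Primrec.snd.comp (Primrec.snd.comp Primrec.snd))
        (RatCode.primrec_neg.comp (hδ.comp Primrec.fst))) (Primrec.fst.comp Primrec.snd)
  refine key.of_iff fun a P => ?_
  rw [hat_lt_iff]
  simp only [exists_eq_right, Rat.cast_pos, Rat.cast_lt]
  refine and_congr_right fun _ => or_congr_right (exists_congr fun e => and_congr_right fun _ => ?_)
  simp only [slack, min_lt_iff, RatCode.val_add, RatCode.val_neg, RatCode.val_divSucc]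
  push_cast
  constructor <;> rintro (h | h)
  · exact .inl (by linarith)
  · exact .inr (by linarith)
  · exact .inl (by linarith)
  · exact .inr (by linarith)

end EffectivelyOpen

/-! ### Approximation of a lower semicomputable function from below -/

/-- An entry `((r, x, β), N)` of an enumeration stands for the function of `ω` and `P` that
vanishes unless `x` is an initial segment of `ω` and is `hat r N P β` otherwise. -/
abbrev Entry : Type := (RatCode × Word × BoxCode) × ℕ

/-- The value at the word `x` of the function that an entry stands for. -/
noncomputable def Entry.value (e : Entry) (x : Word) (P : ProbabilityMeasure Omega) : ℝ≥0 :=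
  if e.1.2.1 <+: x then hat e.1.1 e.2 P e.1.2.2 else 0

/-- The maximum of the functions given by the first `|x|` entries of an enumeration. -/
noncomputable def approx (E : ℕ → Entry) (x : Word) (P : ProbabilityMeasure Omega) : ℝ≥0 :=
  (Finset.range x.length).sup fun i => (E i).value x P

theorem lt_approx_iff {E : ℕ → Entry} {x : Word} {P : ProbabilityMeasure Omega} {q : ℝ}
    (hq : 0 ≤ q) : q < approx E x P ↔ ∃ i, i < x.length ∧ (E i).1.2.1 <+: x ∧
      q < hat (E i).1.1 (E i).2 P (E i).1.2.2 := by
  lift q to ℝ≥0 using hq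
  rw [approx, NNReal.coe_lt_coe, Finset.lt_sup_iff]
  refine exists_congr fun i => and_congr Finset.mem_range ?_
  by_cases h : (E i).1.2.1 <+: x <;> simp [Entry.value, h]

theorem approx_lt_iff {E : ℕ → Entry} {x : Word} {P : ProbabilityMeasure Omega} {s : ℝ} :
    approx E x P < s ↔ 0 < s ∧ ∀ i < x.length, ¬ (E i).1.2.1 <+: x ∨
      hat (E i).1.1 (E i).2 P (E i).1.2.2 < s := by
  rcases le_or_gt s 0 with hs | hs
  · simp [not_lt.2 hs, hs.trans (NNReal.coe_nonneg _)]
  lift s to ℝ≥0 using hs.le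
  have hs' : 0 < s := by exact_mod_cast hs
  rw [approx, NNReal.coe_lt_coe, Finset.sup_lt_iff hs']
  simp only [hs, true_and, Finset.mem_range, NNReal.coe_lt_coe]
  refine forall₂_congr fun i _ => ?_
  by_cases h : (E i).1.2.1 <+: x <;> simp [Entry.value, h, hs']

/-- A longer word admits more entries and has more prefixes. -/
theorem approx_mono (E : ℕ → Entry) {x y : Word} (h : x <+: y) (P : ProbabilityMeasure Omega) :
    approx E x P ≤ approx E y P := by
  refine Finset.sup_le fun i hi => ?_
  refine le_trans ?_ (Finset.le_sup (f := fun i => (E i).value y P)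
    (Finset.range_subset_range.2 h.length_le hi))
  simp only [Entry.value]
  split_ifs with h1 h2
  · exact le_rfl
  · exact absurd (h1.trans h) h2
  · exact zero_le
  · exact le_rfl

theorem primrec_isPrefix : PrimrecRel fun x y : Word => x <+: y :=
  (Primrec.eq.comp Primrec.fst (Primrec.list_take.comp (Primrec.list_length.comp Primrec.fst)
    Primrec.snd)).of_eq fun _ => List.prefix_iff_eq_take.symm

namespace EffectivelyOpen

variable {α : Type*} [Primcodable α] {E : ℕ → Entry}

theorem lt_approx (hE : Primrec E) {q : α → RatCode} {x : α → Word} (hq : Primrec q)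
    (hx : Primrec x) : EffectivelyOpen fun a P => ((q a).val : ℝ) < approx E (x a) P := by
  have hE' : Primrec fun p : α × ℕ => E p.2 := hE.comp Primrec.snd
  have key : EffectivelyOpen fun a P => (q a).val < 0 ∨ ∃ i, i < (x a).length ∧
      (E i).1.2.1 <+: x a ∧ ((q a).val : ℝ) < hat (E i).1.1 (E i).2 P (E i).1.2.2 := by
    refine .or (.of_primrecPred (RatCode.primrec_neg_iff.comp hq)) (.exists' (.and ?_ (.and ?_ ?_)))
    · exact .of_primrecPred (Primrec.nat_lt.comp Primrec.snd
        (Primrec.list_length.comp (hx.comp Primrec.fst)))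
    · exact .of_primrecPred (primrec_isPrefix.comp
        (Primrec.fst.comp (Primrec.snd.comp (Primrec.fst.comp hE'))) (hx.comp Primrec.fst))
    · exact .lt_hat (hq.comp Primrec.fst) (Primrec.fst.comp (Primrec.fst.comp hE'))
        (Primrec.snd.comp hE') (Primrec.snd.comp (Primrec.snd.comp (Primrec.fst.comp hE')))
  refine key.of_iff fun a P => ?_
  rcases lt_or_ge (q a).val 0 with hneg | hnn
  · have : ((q a).val : ℝ) < approx E (x a) P :=
      lt_of_lt_of_le (by exact_mod_cast hneg) (NNReal.coe_nonneg _)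
    simp [hneg, this]
  · rw [lt_approx_iff (by exact_mod_cast hnn)]
    simp [not_lt.2 hnn]

theorem approx_lt (hE : Primrec E) {s : α → RatCode} {x : α → Word} (hs : Primrec s)
    (hx : Primrec x) : EffectivelyOpen fun a P => (approx E (x a) P : ℝ) < (s a).val := by
  have hE' : Primrec fun p : α × ℕ => E p.2 := hE.comp Primrec.snd
  have key : EffectivelyOpen fun a P => 0 < (s a).val ∧ ∀ i < (x a).length,
      ¬ (E i).1.2.1 <+: x a ∨ hat (E i).1.1 (E i).2 P (E i).1.2.2 < ((s a).val : ℝ) := by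
    refine .and (.of_primrecPred (RatCode.primrec_pos_iff.comp hs))
      (.forall_lt (Primrec.list_length.comp hx) (.or ?_ ?_))
    · exact .of_primrecPred (primrec_isPrefix.comp
        (Primrec.fst.comp (Primrec.snd.comp (Primrec.fst.comp hE'))) (hx.comp Primrec.fst)).not
    · exact .hat_lt (hs.comp Primrec.fst) (Primrec.fst.comp (Primrec.fst.comp hE'))
        (Primrec.snd.comp hE') (Primrec.snd.comp (Primrec.snd.comp (Primrec.fst.comp hE')))
  refine key.of_iff fun a P => ?_
  rw [approx_lt_iff, Rat.cast_pos]

end EffectivelyOpen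

/-! ### Increments of the approximation as a semimeasure -/

/-- The increase of the approximation with the last letter of a word. -/
noncomputable def increment (E : ℕ → Entry) (x : Word) (P : ProbabilityMeasure Omega) : ℝ≥0 :=
  approx E x P - approx E x.dropLast P

theorem coe_increment (E : ℕ → Entry) (x : Word) (P : ProbabilityMeasure Omega) :
    (increment E x P : ℝ) = approx E x P - approx E x.dropLast P :=
  NNReal.coe_sub (approx_mono E (List.dropLast_prefix x) P)

/-- This is where `b`, the approximation at the shorter word, must be bounded from above. Without `¬
c.val < 0`, two negative factors could pass the test wrongly. -/
theorem lt_mul_sub_iff {r p a b : ℝ} (hr : 0 ≤ r) (hab : b ≤ a) :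
    r < p * (a - b) ↔ ∃ c q s : RatCode, (¬ c.val < 0 ∧ r < c.val * (q.val - s.val)) ∧
      (c.val : ℝ) < p ∧ (q.val : ℝ) < a ∧ b < s.val := by
  constructor
  · intro h
    have hd : 0 < a - b := by
      rcases (sub_nonneg.2 hab).eq_or_lt with h0 | h0
      · rw [← h0, mul_zero] at h
        exact absurd h (not_lt.2 hr)
      · exact h0
    obtain ⟨c, hc1, hc2⟩ := RatCode.exists_val_btwn ((div_lt_iff₀ hd).2 h)
    have hc0 : (0 : ℝ) < c.val := lt_of_le_of_lt (div_nonneg hr hd.le) hc1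
    have hrc : r / c.val < a - b := by
      rw [div_lt_iff₀ hc0, mul_comm]
      exact (div_lt_iff₀ hd).1 hc1
    -- The room `(a - b) - r / c` is shared equally between `q` and `s`.
    obtain ⟨q, hq1, hq2⟩ := RatCode.exists_val_btwn
      (show a - ((a - b) - r / c.val) / 2 < a by linarith)
    obtain ⟨s, hs1, hs2⟩ := RatCode.exists_val_btwn
      (show b < b + ((a - b) - r / c.val) / 2 by linarith)
    refine ⟨c, q, s, ⟨not_lt.2 (by exact_mod_cast hc0.le), ?_⟩, hc2, hq2, hs1⟩
    rw [← div_lt_iff₀' hc0]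
    linarith
  · rintro ⟨c, q, s, ⟨hc, h⟩, hcp, hqa, hbs⟩
    have hc' : (0 : ℝ) ≤ c.val := by exact_mod_cast not_lt.1 hc
    calc r < c.val * (q.val - s.val) := h
      _ ≤ c.val * (a - b) := mul_le_mul_of_nonneg_left (by linarith) hc'
      _ ≤ p * (a - b) := mul_le_mul_of_nonneg_right hcp.le (sub_nonneg.2 hab)

theorem lowerFunction_increment {E : ℕ → Entry} (hE : Primrec E) :
    LowerFunction fun x P => (increment E x P : ℝ≥0∞) * (P : Measure Omega) (cyl x) := by
  have hdrop : Primrec fun x : Word => x.dropLast :=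
    (Primrec.list_take.comp (Primrec.nat_sub.comp Primrec.list_length (Primrec.const 1))
      Primrec.id).of_eq fun x => List.dropLast_eq_take.symm
  have key : EffectivelyOpen fun (p : RatCode × Word) P => p.1.val < 0 ∨ ∃ c q s : RatCode,
      (¬ c.val < 0 ∧ p.1.val < (c.mul (q.add s.neg)).val) ∧
      (c.val : ℝ) < (P : Measure Omega).real (cyl p.2) ∧
      (q.val : ℝ) < approx E p.2 P ∧ (approx E p.2.dropLast P : ℝ) < s.val := by
    have h2 : Primrec fun z : (((RatCode × Word) × RatCode) × RatCode) × RatCode => z.1.1.1.2 :=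
      Primrec.snd.comp (Primrec.fst.comp (Primrec.fst.comp Primrec.fst))
    have hc : Primrec fun z : (((RatCode × Word) × RatCode) × RatCode) × RatCode => z.1.1.2 :=
      Primrec.snd.comp (Primrec.fst.comp Primrec.fst)
    have hq : Primrec fun z : (((RatCode × Word) × RatCode) × RatCode) × RatCode => z.1.2 :=
      Primrec.snd.comp Primrec.fst
    refine .or (.of_primrecPred (RatCode.primrec_neg_iff.comp Primrec.fst))
      (.exists' (.exists' (.exists' (.and (.of_primrecPred (.and ?_ ?_)) (.and ?_ (.and ?_ ?_))))))
    · exact (RatCode.primrec_neg_iff.comp hc).not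
    · exact RatCode.primrec_lt.comp
        (Primrec.fst.comp (Primrec.fst.comp (Primrec.fst.comp Primrec.fst)))
        (RatCode.primrec_mul.comp hc
          (RatCode.primrec_add.comp hq (RatCode.primrec_neg.comp Primrec.snd)))
    · exact .lt_measure hc h2
    · exact .lt_approx hE hq h2
    · exact .approx_lt hE Primrec.snd (hdrop.comp h2)
  refine key.of_iff fun p P => ?_
  rcases lt_or_ge p.1.val 0 with hneg | hnn
  · simp [hneg, ratLT_of_neg hneg]
  have hr : (0 : ℝ) ≤ p.1.val := by exact_mod_cast hnn
  have hval : (increment E p.2 P : ℝ≥0∞) * (P : Measure Omega) (cyl p.2) =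
      ENNReal.ofReal ((P : Measure Omega).real (cyl p.2) *
        (approx E p.2 P - approx E p.2.dropLast P)) := by
    rw [ENNReal.ofReal_mul measureReal_nonneg, ofReal_measureReal, ← coe_increment,
      ENNReal.ofReal_coe_nnreal, mul_comm]
  have hmono : (approx E p.2.dropLast P : ℝ) ≤ approx E p.2 P :=
    NNReal.coe_le_coe.2 (approx_mono E (List.dropLast_prefix p.2) P)
  beta_reduce
  rw [ratLT_iff_of_nonneg hnn, hval, ENNReal.ofReal_lt_ofReal_iff_of_nonneg hr,
    lt_mul_sub_iff hr hmono]
  simp only [not_lt.2 hnn, false_or, RatCode.val_mul, RatCode.val_add, RatCode.val_neg,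
    ← sub_eq_add_neg]
  refine exists_congr fun c => exists_congr fun q => exists_congr fun s => ?_
  refine and_congr_left' (and_congr_right' ?_)
  exact_mod_cast Iff.rfl

/-- An enumeration of entries that lie below `t` and exhaust it. -/
structure Enumerates (E : ℕ → Entry) (t : Omega → ProbabilityMeasure Omega → ℝ≥0∞) : Prop where
  le : ∀ i ω P, ω ∈ cyl (E i).1.2.1 → P ∈ (E i).1.2.2.toSet →
    ENNReal.ofReal (E i).1.1.val ≤ t ω P
  exists_entry : ∀ (r : RatCode) ω P, RatLT r.val (t ω P) →
    ∃ (x : Word) (β : BoxCode), ω ∈ cyl x ∧ P ∈ β.toSet ∧ ∀ N, ∃ i, E i = ((r, x, β), N)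

theorem LowerSemicomputable.exists_enumeration {t : Omega → ProbabilityMeasure Omega → ℝ≥0∞}
    (ht : LowerSemicomputable t) : ∃ E : ℕ → Entry, Primrec E ∧ Enumerates E t := by
  obtain ⟨A, hA, hAt⟩ := ht
  obtain ⟨g, hg, hgA⟩ := exists_primrec_of_rePred hA
  -- Codes that are invalid or not yet confirmed yield `d`, whose function is `0`. Since `i` codes
  -- `N` too, every confirmed box occurs with all `N`.
  let d : Entry := (((0, 0), [], []), 0)
  let h : Entry × ℕ → Entry := fun e => cond (g e.1.1 e.2) e.1 d
  let E : ℕ → Entry := fun i => ((Encodable.decode (α := Entry × ℕ) i).map h).getD d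
  have hh : Primrec h := Primrec.cond (hg.comp (Primrec.fst.comp Primrec.fst) Primrec.snd)
    Primrec.fst (Primrec.const _)
  have hEp : Primrec E := Primrec.option_getD.comp
    (Primrec.option_map Primrec.decode (hh.comp Primrec.snd)) (Primrec.const _)
  have hEA : ∀ i, A (E i).1 ∨ E i = d := fun i => by
    cases hd : Encodable.decode (α := Entry × ℕ) i with
    | none => exact .inr (by simp only [E, hd, Option.map_none, Option.getD_none])
    | some e =>
      cases hge : g e.1.1 e.2 with
      | false =>
        exact .inr (by simp only [E, hd, h, hge, Option.map_some, Option.getD_some, cond_false])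
      | true =>
        refine .inl ?_
        simp only [E, hd, h, hge, Option.map_some, Option.getD_some, cond_true]
        exact (hgA e.1.1).2 ⟨_, hge⟩
  have hEe : ∀ e : Entry, A e.1 → ∃ i, E i = e := fun e he => by
    obtain ⟨s, hs⟩ := (hgA _).1 he
    refine ⟨Encodable.encode (e, s), ?_⟩
    simp only [E, Encodable.encodek, Option.map_some, Option.getD_some, h, hs, cond_true]
  clear_value E
  refine ⟨E, hEp, ?_, ?_⟩
  · intro i ω P hω hP
    rcases hEA i with hE | hE
    · rcases ratLT_iff.1 ((hAt (E i).1.1 ω P).2 ⟨(E i).1.2.1, (E i).1.2.2, hE, hω, hP⟩)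
        with h0 | h0
      · rw [ENNReal.ofReal_of_nonpos (by exact_mod_cast h0.le)]
        exact zero_le
      · exact h0.le
    · rw [hE]
      simp only [d, RatCode.val_zero, Rat.cast_zero, ENNReal.ofReal_zero]
      exact zero_le
  · intro r ω P hr
    obtain ⟨x, β, hAx, hω, hP⟩ := (hAt r ω P).1 hr
    exact ⟨x, β, hω, hP, fun N => hEe ((r, x, β), N) hAx⟩

namespace Enumerates

variable {E : ℕ → Entry} {t : Omega → ProbabilityMeasure Omega → ℝ≥0∞}

/-- Each `hat` vanishes off its box and is at most its rational, so it stays below `t`; on the box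
it reaches that rational for large `N`. -/
theorem iSup_approx (hE : Enumerates E t) (ω : Omega) (P : ProbabilityMeasure Omega) :
    ⨆ n, (approx E (initialWord ω n) P : ℝ≥0∞) = t ω P := by
  refine le_antisymm (iSup_le fun n => ?_) (le_of_forall_lt fun c hc => ?_)
  · by_contra! hlt
    obtain ⟨q, hq1, hq2⟩ := ENNReal.lt_iff_exists_nnreal_btwn.1 hlt
    obtain ⟨i, -, hpre, hhat⟩ := (lt_approx_iff (NNReal.coe_nonneg q)).1
      (NNReal.coe_lt_coe.2 (ENNReal.coe_lt_coe.1 hq2))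
    have hhat' : q < hat (E i).1.1 (E i).2 P (E i).1.2.2 := hhat
    have hle := hE.le i ω P (isPrefix_initialWord_iff.1 hpre).2
      (mem_toSet_of_hat_pos (zero_le.trans_lt hhat'))
    have h1 : (q : ℝ≥0∞) ≤ ENNReal.ofReal (E i).1.1.val :=
      ENNReal.coe_le_coe.2 (hhat'.le.trans (hat_le _ _ _ _))
    exact absurd (hq1.trans_le (h1.trans hle)) (lt_irrefl _)
  · have hct : c ≠ ∞ := ne_top_of_lt hc
    obtain ⟨r, hr1, hr2⟩ := exists_ratCode_btwn (a := c.toReal) ENNReal.toReal_nonneg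
      (by rwa [ENNReal.ofReal_toReal hct])
    obtain ⟨x, β, hω, hP, hN⟩ := hE.exists_entry r ω P hr2
    obtain ⟨N, hle⟩ := (eventually_le_hat r hP).exists
    obtain ⟨i, hi⟩ := hN N
    -- The length must exceed `i` for the entry to count, and reach `|x|` for `x` to be a prefix.
    have hpre : x <+: initialWord ω (max (i + 1) x.length) :=
      isPrefix_initialWord_iff.2 ⟨le_max_right _ _, hω⟩
    have hval : (E i).value (initialWord ω (max (i + 1) x.length)) P = hat r N P β := by
      simp [Entry.value, hi, hpre]
    have hle' : hat r N P β ≤ approx E (initialWord ω (max (i + 1) x.length)) P := by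
      rw [← hval]
      exact Finset.le_sup (f := fun i => (E i).value _ P) (by simp)
    refine lt_of_lt_of_le ?_ (le_iSup_of_le (max (i + 1) x.length)
      (ENNReal.coe_le_coe.2 (hle.trans hle')))
    exact (ENNReal.lt_ofReal_iff_toReal_lt hct).2 hr1

theorem sum_increment (E : ℕ → Entry) (ω : Omega) (P : ProbabilityMeasure Omega) (n : ℕ) :
    ∑ j ∈ Finset.range (n + 1), increment E (initialWord ω j) P =
      approx E (initialWord ω n) P := by
  induction n with
  -- The telescoping sum starts at `0`: at the empty word no entry is admitted.
  | zero => simp [increment, approx, initialWord]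
  | succ n ih =>
    rw [Finset.sum_range_succ, ih, increment, dropLast_initialWord, Nat.add_sub_cancel]
    refine add_tsub_cancel_of_le (approx_mono E ?_ P)
    exact isPrefix_initialWord_iff.2 ⟨by simp, isInitial_initialWord ω n⟩

theorem tsum_increment (hE : Enumerates E t) (ω : Omega) (P : ProbabilityMeasure Omega) :
    ∑' n, (increment E (initialWord ω n) P : ℝ≥0∞) = t ω P := by
  rw [← hE.iSup_approx ω P, ENNReal.tsum_eq_iSup_nat]
  simp only [← sum_increment, ENNReal.ofNNReal_finsetSum]
  refine le_antisymm (iSup_le fun n => le_iSup_of_le n ?_)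
    (iSup_le fun n => le_iSup_of_le (n + 1) le_rfl)
  exact Finset.sum_le_sum_of_subset (Finset.range_subset_range.2 n.le_succ)

theorem isUniformSemimeasure (hE : Enumerates E t) (hE' : Primrec E) (ht : IsUniformTest t) :
    IsUniformSemimeasure
      fun x P => (increment E x P : ℝ≥0∞) * (P : Measure Omega) (cyl x) where
  lowerSemicomputable := lowerSemicomputableOnWords_iff.2 (lowerFunction_increment hE')
  tsum_le_one P := by
    rw [← lintegral_tsum_initial (P : Measure Omega) fun x => (increment E x P : ℝ≥0∞)]
    refine le_trans (le_of_eq (lintegral_congr fun ω => ?_)) (ht.lintegral_le_one P)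
    rw [tsum_initial ω fun x => (increment E x P : ℝ≥0∞), hE.tsum_increment]

end Enumerates

/-! ### Positivity of the a priori probability -/

/-- A strictly positive semimeasure; maximality then makes `m` positive everywhere. -/
theorem isUniformSemimeasure_two_pow :
    IsUniformSemimeasure fun x _ => (2⁻¹ : ℝ≥0∞) ^ (Encodable.encode x + 1) where
  lowerSemicomputable := by
    refine lowerSemicomputableOnWords_iff.2 ?_
    have hpow : Primrec₂ fun a b : ℕ => a ^ b := Primrec₂.unpaired'.1 Nat.Primrec.pow
    have key : EffectivelyOpen fun (p : RatCode × Word) (_ : ProbabilityMeasure Omega) =>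
        (p.1.mul (((2 ^ (Encodable.encode p.2 + 1) : ℕ) : ℤ), 0)).val < RatCode.val (1, 0) :=
      .of_primrecPred (RatCode.primrec_lt.comp (RatCode.primrec_mul.comp Primrec.fst
        (Primrec.pair (primrec_natCast_int.comp (hpow.comp (Primrec.const 2)
          (Primrec.succ.comp (Primrec.encode.comp Primrec.snd)))) (Primrec.const 0)))
        (Primrec.const _))
    refine key.of_iff fun p P => ?_
    rw [RatCode.val_mul, RatCode.val_natCast]
    have h1 : RatCode.val (1, 0) = 1 := by simp [RatCode.val]
    rw [h1]
    beta_reduce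
    set k := Encodable.encode p.2 + 1
    have h2k : (0 : ℚ) < ((2 ^ k : ℕ) : ℚ) := by positivity
    rcases lt_or_ge p.1.val 0 with hneg | hnn
    · have : p.1.val * ((2 ^ k : ℕ) : ℚ) < 1 :=
        (mul_neg_of_neg_of_pos hneg h2k).trans one_pos
      exact iff_of_true (ratLT_of_neg hneg _) this
    · have hr : (0 : ℝ) ≤ p.1.val := by exact_mod_cast hnn
      have hp : (2⁻¹ : ℝ≥0∞) ^ k = ENNReal.ofReal (1 / ((2 ^ k : ℕ) : ℝ)) := by
        rw [ENNReal.ofReal_div_of_pos (by positivity), ENNReal.ofReal_natCast,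
          ENNReal.ofReal_one, one_div, Nat.cast_pow, ENNReal.inv_pow]
        rfl
      rw [ratLT_iff_of_nonneg hnn, hp, ENNReal.ofReal_lt_ofReal_iff_of_nonneg hr,
        lt_div_iff₀ (by positivity)]
      exact_mod_cast Iff.rfl
  tsum_le_one _ := by
    calc ∑' x : Word, (2⁻¹ : ℝ≥0∞) ^ (Encodable.encode x + 1)
        ≤ ∑' n : ℕ, (2⁻¹ : ℝ≥0∞) ^ (n + 1) :=
          ENNReal.tsum_comp_le_tsum_of_injective Encodable.encode_injective _
      _ = 1 := by
          rw [ENNReal.tsum_geometric_add_one, ENNReal.one_sub_inv_two, inv_inv]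
          exact ENNReal.inv_mul_cancel (by simp) (by simp)

theorem IsAprioriProbability.pos {m : Word → ProbabilityMeasure Omega → ℝ≥0∞}
    (hm : IsAprioriProbability m) (x : Word) (P : ProbabilityMeasure Omega) : m x P ≠ 0 := by
  obtain ⟨c, hc⟩ := hm.maximal _ isUniformSemimeasure_two_pow
  intro h0
  have := hc x P
  simp [h0] at this

/-! ### Domination of every uniform test by the sum over initial segments -/

theorem IsAprioriProbability.test_le_initialSum
    {m : Word → ProbabilityMeasure Omega → ℝ≥0∞} (hm : IsAprioriProbability m)
    {t : Omega → ProbabilityMeasure Omega → ℝ≥0∞} (ht : IsUniformTest t) :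
    ∃ c : ℝ≥0, ∀ ω P, t ω P ≤ c * initialSum m ω P := by
  obtain ⟨E, hE', hE⟩ := ht.lowerSemicomputable.exists_enumeration
  obtain ⟨c, hc⟩ := hm.maximal _ (hE.isUniformSemimeasure hE' ht)
  -- The constant must be nonzero, since `0 * ∞ = 0` would spoil the case of a null prefix.
  refine ⟨c + 1, fun ω P => ?_⟩
  rw [initialSum, tsum_initial ω fun x => m x P / (P : Measure Omega) (cyl x)]
  -- At a null prefix the semimeasure bound says nothing about the increment, but positivity of `m`
  -- makes the sum infinite.
  by_cases h0 : ∃ n, (P : Measure Omega) (cyl (initialWord ω n)) = 0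
  · obtain ⟨n, hn⟩ := h0
    have htop : ∑' n, m (initialWord ω n) P /
        (P : Measure Omega) (cyl (initialWord ω n)) = ∞ := by
      refine ENNReal.tsum_eq_top_of_eq_top ⟨n, ?_⟩
      rw [hn, ENNReal.div_zero (hm.pos _ P)]
    rw [htop, ENNReal.mul_top (by simp)]
    exact le_top
  · push Not at h0
    rw [← hE.tsum_increment ω P, ← ENNReal.tsum_mul_left]
    refine ENNReal.tsum_le_tsum fun n => ?_
    rw [← mul_div_assoc, ENNReal.le_div_iff_mul_le (.inl (h0 n)) (.inl (measure_ne_top _ _))]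
    refine (hc (initialWord ω n) P).trans ?_
    gcongr
    simp

end CantorRandomness

theorem mainTheorem4
    (t : (ℕ → Bool) → MeasureTheory.ProbabilityMeasure (ℕ → Bool) → ENNReal)
    (ht : CantorRandomness.IsUniversalUniformTest t)
    (m : List Bool → MeasureTheory.ProbabilityMeasure (ℕ → Bool) → ENNReal)
    (hm : CantorRandomness.IsAprioriProbability m) :
    CantorRandomness.EqUpToFactor t (CantorRandomness.initialSum m) :=
  ⟨hm.test_le_initialSum ht.isUniformTest,
    ht.maximal _ (CantorRandomness.isUniformTest_initialSum hm.isUniformSemimeasure)⟩
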